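/- For words $y\in\{0,1\}^m$ and $x\in\{0,1\}^n$, let the embedding number $\omega_y(x)$ be the number of index tuples $1\le i_1<\dots<i_m\le n$ with $x_{i_j}=y_j$ for all $j$. Let $m\ge 0$ and $n=m+2$. In the binary 2-deletion channel a word $x\in\{0,1\}^n$ is transmitted and exactly two symbols, whose positions are chosen uniformly at random among the $\binom n2$ pairs, are deleted, so that $\Pr(y\mid x)=\omega_y(x)/\binom n2$ for $y\in\{0,1\}^m$. Let the transmitted word $X$ be uniformly distributed on $\{0,1\}^n$, let $Y$ be the received word, and let $$\mathsf H^{\mathsf{In}}_{2\text{-}\mathsf{Del}}(y)=H(X\mid Y=y)=-\sum_{x\in\{0,1\}^n}\Pr(x\mid y)\log_2\Pr(x\mid y)$$ be the input entropy of $y\in\{0,1\}^m$, where $\Pr(x\mid y)$ is the posterior probability and $0\log_2 0=0$. Then $y\in\{0,1\}^m$ minimizes $\mathsf H^{\mathsf{In}}_{2\text{-}\mathsf{Del}}$ over $\{0,1\}^m$ if and only if $y$ is a constant word $\sigma^m$ with $\sigma\in\{0,1\}$, and for each $\sigma\in\{0,1\}$ $$\min_{y\in\{0,1\}^m}\mathsf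 H^{\mathsf{In}}_{2\text{-}\mathsf{Del}}(y)=\mathsf H^{\mathsf{In}}_{2\text{-}\mathsf{Del}}(\sigma^m)=2+\frac34\log_2\binom n2-\frac12\log_2(m+1).$$ -/

import Mathlib

namespace DeletionChannel

/-- Words of length `n` over the alphabet `{0, …, q - 1}`. -/
abbrev Word (q n : ℕ) : Type := Fin n → Fin q

/-- The embedding number of `y` in `x`: the number of increasing index tuples
`i 0 < i 1 < ⋯ < i (m - 1)` of positions of `x` at which `x` spells `y`. -/
def embeddingNumber {q m n : ℕ} (y : Word q m) (x : Word q n) : ℕ :=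
  (Finset.univ.filter fun i : Fin m → Fin n =>
    (∀ a b, a < b → i a < i b) ∧ ∀ j, x (i j) = y j).card

/-- The constant word `σ^m`. -/
def constWord {q : ℕ} (m : ℕ) (σ : Fin q) : Word q m := fun _ => σ

noncomputable section

/-- The posterior probability that `x` was transmitted given that `y` was received, for a channel
with transition probabilities `W x y = Pr(y received | x transmitted)` and the input
distribution `P`. -/
def posterior {X Y : Type*} [Fintype X] (W : X → Y → ℝ) (P : X → ℝ) (y : Y) (x : X) : ℝ :=
  W x y * P x / ∑ x', W x' y * P x'

/-- The Shannon entropy in bits of a probability mass function on a finite set. -/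
def entropy {X : Type*} [Fintype X] (p : X → ℝ) : ℝ :=
  -∑ x, p x * Real.logb 2 (p x)

/-- The input entropy `H(X | Y = y)` of the received word `y`. -/
def inputEntropy {X Y : Type*} [Fintype X] (W : X → Y → ℝ) (P : X → ℝ) (y : Y) : ℝ :=
  entropy (posterior W P y)

/-- The transition probabilities of the `k`-deletion channel on words of length `m + k`: a set of
exactly `k` positions, chosen uniformly at random, is deleted from the transmitted word `x`. -/
def delChannel (q k m : ℕ) (x : Word q (m + k)) (y : Word q m) : ℝ :=
  (embeddingNumber y x : ℝ) / ((m + k).choose k : ℝ)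

/-- Uniform transmission: every word of length `n` is transmitted with the same probability. -/
def uniformInput (q n : ℕ) (_x : Word q n) : ℝ := 1 / (Fintype.card (Word q n) : ℝ)

/-- The input entropy of `y` over the `k`-deletion channel under uniform transmission. -/
def delInputEntropy (q k m : ℕ) (y : Word q m) : ℝ :=
  inputEntropy (delChannel q k m) (uniformInput q (m + k)) y

end

end DeletionChannel

/-! The sum of `embeddingNumber y x` over all `x` is the same number `T` for every `y`, so the input
entropy is `log T - (∑ ω log ω) / T`, and minimizing it means maximizing a sum of the strictly
convex function `k log k` over the embedding numbers. Those of a constant word majorize those of any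
`y`: every truncated sum `∑ (ω - t)⁺` is largest for a constant word (`sum_hinge_le_constWord`, by
induction on the length of `x`). Since `k log k` is a positive combination of such hinges, the
inequality carries over. It is strict for nonconstant `y` because the hinge just below the maximal
value `n.choose m` vanishes for `y` but not for a constant word. -/

namespace DeletionChannel

open Finset

/-! ### Recursion on the first letter of the long word. -/

section Recursion

variable {q : ℕ}

theorem embeddingNumber_zero_left {n : ℕ} (y : Word q 0) (x : Word q n) :
    embeddingNumber y x = 1 := by
  simp [embeddingNumber]

theorem embeddingNumber_zero_right {m : ℕ} (y : Word q (m + 1)) (x : Word q 0) :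
    embeddingNumber y x = 0 := by
  simp only [embeddingNumber, card_eq_zero]
  ext i
  exact (i 0).elim0

/-- Splitting embeddings according to whether they use the first letter of the long word. -/
theorem embeddingNumber_cons {m n : ℕ} (y : Word q (m + 1)) (b : Fin q) (x : Word q n) :
    embeddingNumber y (Fin.cons b x : Word q (n + 1)) =
      embeddingNumber y x + if b = y 0 then embeddingNumber (Fin.tail y) x else 0 := by
  have hne : ∀ i : Fin (m + 1) → Fin (n + 1), (∀ a b, a < b → i a < i b) → i 0 ≠ 0 →
      ∀ j, i j ≠ 0 := by
    intro i hi h0 j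
    rcases Fin.eq_zero_or_eq_succ j with rfl | ⟨k, rfl⟩
    · exact h0
    · exact Fin.ne_zero_of_lt (hi 0 k.succ (Fin.succ_pos k))
  simp only [embeddingNumber]
  rw [← card_filter_add_card_filter_not (fun i : Fin (m + 1) → Fin (n + 1) => i 0 ≠ 0)]
  congr 1
  · symm
    refine card_bij (fun i _ j => (i j).succ) ?_ ?_ ?_
    · intro i hi
      simpa [Fin.succ_ne_zero] using hi
    · intro i _ i' _ h
      funext j
      exact Fin.succ_injective _ (congrFun h j)
    · intro i hi
      simp only [mem_filter, mem_univ, true_and] at hi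
      obtain ⟨⟨hmono, hx⟩, h0⟩ := hi
      have hj := hne i hmono h0
      refine ⟨fun j => (i j).pred (hj j), ?_, by simp⟩
      simp only [mem_filter, mem_univ, true_and]
      refine ⟨fun a b hab => by simpa using hmono a b hab, fun j => ?_⟩
      rw [← hx j]
      conv_rhs => rw [← Fin.succ_pred (i j) (hj j), Fin.cons_succ]
  · split_ifs with hb
    · symm
      refine card_bij (fun i _ => Fin.cons 0 fun j => (i j).succ) ?_ ?_ ?_
      · intro i hi
        simp only [mem_filter, mem_univ, true_and] at hi
        simp only [mem_filter, mem_univ, true_and]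
        refine ⟨⟨?_, ?_⟩, by simp⟩
        · intro a c hac
          induction c using Fin.cases with
          | zero => simp at hac
          | succ c =>
            induction a using Fin.cases with
            | zero => simp
            | succ a => simpa using hi.1 a c (by simpa using hac)
        · intro j
          induction j using Fin.cases with
          | zero => simpa using hb
          | succ j => simpa [Fin.tail] using hi.2 j
      · intro i _ i' _ h
        funext j
        simpa using congrFun h j.succ
      · intro i hi
        simp only [mem_filter, mem_univ, true_and, not_not] at hi
        obtain ⟨⟨hmono, hx⟩, h0⟩ := hi
        have hj : ∀ j : Fin m, i j.succ ≠ 0 := fun j =>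
          Fin.ne_zero_of_lt (hmono 0 j.succ (Fin.succ_pos j))
        refine ⟨fun j => (i j.succ).pred (hj j), ?_, ?_⟩
        · simp only [mem_filter, mem_univ, true_and]
          refine ⟨fun a c hac => by simpa using hmono a.succ c.succ (by simpa using hac),
            fun j => ?_⟩
          rw [Fin.tail, ← hx j.succ]
          conv_rhs => rw [← Fin.succ_pred (i j.succ) (hj j), Fin.cons_succ]
        · funext j
          induction j using Fin.cases with
          | zero => simp [h0]
          | succ j => simp
    · rw [card_eq_zero]
      ext i
      simp only [mem_filter, mem_univ, true_and, not_not, notMem_empty, iff_false]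
      rintro ⟨⟨-, hx⟩, h0⟩
      exact hb (by simpa [h0] using hx 0)

theorem sum_word_succ {M : Type*} [AddCommMonoid M] {n : ℕ} (g : Word q (n + 1) → M) :
    ∑ x, g x = ∑ b : Fin q, ∑ x : Word q n, g (Fin.cons b x) := by
  rw [← Fintype.sum_prod_type']
  exact (Fintype.sum_equiv (Fin.consEquiv fun _ => Fin q) _ _ fun _ => rfl).symm

end Recursion

/-! ### Embedding numbers of constant words. -/

section Weight

variable {q : ℕ}

/-- The number of occurrences of the letter `σ` in `x`. -/
def weight (σ : Fin q) {n : ℕ} (x : Word q n) : ℕ := ∑ i, if x i = σ then 1 else 0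

theorem weight_cons (σ b : Fin q) {n : ℕ} (x : Word q n) :
    weight σ (Fin.cons b x : Word q (n + 1)) = weight σ x + if b = σ then 1 else 0 := by
  rw [weight, Fin.sum_univ_succ, add_comm]
  rfl

theorem weight_le (σ : Fin q) {n : ℕ} (x : Word q n) : weight σ x ≤ n := by
  calc weight σ x ≤ ∑ _i : Fin n, 1 := sum_le_sum fun i _ => by split_ifs <;> simp
    _ = n := by simp

theorem weight_constWord (σ : Fin q) (n : ℕ) : weight σ (constWord n σ) = n := by
  simp [weight, constWord]

/-- Embeddings are the `m`-subsets of the positions carrying `σ`. Hence the value is monotone in the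
weight of `x`, which the majorization argument exploits. -/
theorem embeddingNumber_constWord (σ : Fin q) {n : ℕ} (m : ℕ) (x : Word q n) :
    embeddingNumber (constWord m σ) x = (weight σ x).choose m := by
  induction n generalizing m with
  | zero =>
    cases m with
    | zero => simp [embeddingNumber_zero_left]
    | succ m => simp [embeddingNumber_zero_right, weight]
  | succ n ih =>
    cases m with
    | zero => simp [embeddingNumber_zero_left]
    | succ m =>
      rw [← Fin.cons_self_tail x, embeddingNumber_cons, weight_cons, ih]
      have htail : Fin.tail (constWord (m + 1) σ) = constWord m σ := rfl
      rw [htail, ih]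
      by_cases h : x 0 = σ
      · rw [if_pos h, if_pos (show x 0 = constWord (m + 1) σ 0 from h), Nat.choose_succ_succ, add_comm]
      · simp [h, constWord]

end Weight

/-! ### Total embedding count and majorization by constant words. -/

section Binary

theorem sum_binary (a : Fin 2) {M : Type*} [AddCommMonoid M] (u v : M) :
    ∑ b : Fin 2, (if b = a then u else v) = v + u := by
  fin_cases a <;> simp [Fin.sum_univ_two, add_comm]

/-- Exactly one of the two possible first letters matches `y 0`, so the recursion has the same shape
for every `y`. -/
theorem sum_embeddingNumber_succ {M : Type*} [AddCommMonoid M] (g : ℕ → M) {m n : ℕ}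
    (y : Word 2 (m + 1)) :
    ∑ x : Word 2 (n + 1), g (embeddingNumber y x) =
      ∑ x : Word 2 n, g (embeddingNumber y x) +
        ∑ x : Word 2 n, g (embeddingNumber y x + embeddingNumber (Fin.tail y) x) := by
  rw [sum_word_succ]
  refine Eq.trans ?_ (sum_binary (y 0) _ _)
  refine sum_congr rfl fun b _ => ?_
  split_ifs with h <;> exact sum_congr rfl fun x _ => by simp [embeddingNumber_cons, h]

theorem sum_weight (σ : Fin 2) {R : Type*} [CommSemiring R] (g : ℕ → R) (n : ℕ) :
    ∑ x : Word 2 n, g (weight σ x) = ∑ w ∈ range (n + 1), (n.choose w : R) * g w := by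
  induction n generalizing g with
  | zero => simp [weight]
  | succ n ih =>
    have h : ∑ x : Word 2 (n + 1), g (weight σ x) =
        ∑ x : Word 2 n, g (weight σ x) + ∑ x : Word 2 n, g (weight σ x + 1) := by
      rw [sum_word_succ]
      refine Eq.trans ?_ (sum_binary σ _ _)
      refine sum_congr rfl fun b _ => ?_
      split_ifs with h <;> exact sum_congr rfl fun x _ => by simp [weight_cons, h]
    have h' : ∑ w ∈ range (n + 1), (n.choose w : R) * g w =
        ∑ w ∈ range (n + 1), (n.choose (w + 1) : R) * g (w + 1) + g 0 := by
      have e := sum_range_succ' (fun w => (n.choose w : R) * g w) (n + 1)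
      rw [sum_range_succ] at e
      simpa using e
    rw [h, ih, ih fun w => g (w + 1), h', sum_range_succ' _ (n + 1)]
    simp only [Nat.choose_succ_succ, Nat.cast_add, add_mul, sum_add_distrib, Nat.choose_zero_right,
      Nat.cast_one, one_mul]
    ring

/-- The total number of embeddings of a word of length `m` into words of length `m + k`. -/
theorem sum_embeddingNumber (k : ℕ) {m : ℕ} (y : Word 2 m) :
    ∑ x : Word 2 (m + k), embeddingNumber y x = (m + k).choose k * 2 ^ k := by
  -- Multiplying by `2 ^ m` avoids the exponent `n - m`, so the induction also covers `m > n`.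
  suffices H : ∀ (n m : ℕ) (y : Word 2 m),
      2 ^ m * ∑ x : Word 2 n, embeddingNumber y x = n.choose m * 2 ^ n by
    have := H (m + k) m y
    rw [pow_add, Nat.choose_symm_add, mul_left_comm] at this
    exact Nat.eq_of_mul_eq_mul_left (by positivity) this
  intro n
  induction n with
  | zero =>
    intro m y
    cases m with
    | zero => simp [embeddingNumber_zero_left]
    | succ m => simp [embeddingNumber_zero_right]
  | succ n ih =>
    intro m y
    cases m with
    | zero => simp [embeddingNumber_zero_left]
    | succ m =>
      have e := sum_embeddingNumber_succ (n := n) id y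
      simp only [id, sum_add_distrib] at e
      have h₁ := ih (m + 1) y
      have h₂ := ih m (Fin.tail y)
      rw [e, Nat.choose_succ_succ]
      rw [pow_succ] at h₁ ⊢
      rw [pow_succ 2 n]
      linear_combination 2 * h₁ + 2 * h₂

/-- Two monotone sequences are comonotone, so the hinge of their sum splits. -/
theorem exists_hinge_split {g h : ℕ → ℕ} (hg : Monotone g) (hh : Monotone h) (N t : ℕ) :
    ∃ t₁ t₂, t₁ + t₂ = t ∧ ∀ w ≤ N, (g w - t₁) + (h w - t₂) = g w + h w - t := by
  by_cases hN : t ≤ g N + h N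
  · have hex : ∃ w, t ≤ g w + h w := ⟨N, hN⟩
    obtain ⟨w₀, hw₀, hmin⟩ : ∃ w₀, t ≤ g w₀ + h w₀ ∧ ∀ w < w₀, ¬ t ≤ g w + h w :=
      ⟨Nat.find hex, Nat.find_spec hex, fun w hw => Nat.find_min hex hw⟩
    rcases w₀ with _ | k
    · refine ⟨min (g 0) t, t - min (g 0) t, by omega, fun w _ => ?_⟩
      have := hg (Nat.zero_le w)
      have := hh (Nat.zero_le w)
      omega
    · have hk := hmin k (Nat.lt_succ_self k)
      have := hg (Nat.le_succ k)
      have := hh (Nat.le_succ k)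
      -- The sum crosses `t` between `k` and `k + 1`; this choice puts `t₁` in `[g k, g (k + 1)]`
      -- and `t₂` in `[h k, h (k + 1)]`, so both hinges switch on together.
      refine ⟨max (g k) (t - h (k + 1)), t - max (g k) (t - h (k + 1)), by omega, fun w _ => ?_⟩
      rcases Nat.lt_or_ge k w with hw | hw
      · have := hg (Nat.succ_le_of_lt hw)
        have := hh (Nat.succ_le_of_lt hw)
        simp only [Nat.succ_eq_add_one] at *
        omega
      · have := hg hw
        have := hh hw
        simp only [Nat.succ_eq_add_one] at *
        omega
  · refine ⟨g N, t - g N, by omega, fun w hw => ?_⟩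
    have := hg hw
    have := hh hw
    omega

/-- The embedding numbers of any word are majorized by those of a constant word. -/
theorem sum_hinge_le_constWord (σ : Fin 2) (n : ℕ) {m : ℕ} (y : Word 2 m) (t : ℕ) :
    ∑ x : Word 2 n, (embeddingNumber y x - t) ≤
      ∑ x : Word 2 n, (embeddingNumber (constWord m σ) x - t) := by
  induction n generalizing m t with
  | zero =>
    cases m with
    | zero => simp [embeddingNumber_zero_left]
    | succ m => simp [embeddingNumber_zero_right]
  | succ n ih =>
    cases m with
    | zero => simp [embeddingNumber_zero_left]
    | succ m =>
      rw [sum_embeddingNumber_succ (fun k => k - t), sum_embeddingNumber_succ (fun k => k - t)]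
      refine add_le_add (ih y t) ?_
      -- The split is exact for the constant word, both of whose terms increase with the weight; for
      -- `y` subadditivity of the hinge suffices.
      obtain ⟨t₁, t₂, rfl, hsplit⟩ :=
        exists_hinge_split (Nat.choose_mono (m + 1)) (Nat.choose_mono m) n t
      have htail : Fin.tail (constWord (m + 1) σ) = constWord m σ := rfl
      calc ∑ x : Word 2 n, (embeddingNumber y x + embeddingNumber (Fin.tail y) x - (t₁ + t₂))
          ≤ ∑ x : Word 2 n, ((embeddingNumber y x - t₁) +
              (embeddingNumber (Fin.tail y) x - t₂)) := sum_le_sum fun x _ => by omega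
        _ ≤ ∑ x : Word 2 n, ((embeddingNumber (constWord (m + 1) σ) x - t₁) +
              (embeddingNumber (constWord m σ) x - t₂)) := by
          rw [sum_add_distrib, sum_add_distrib]
          exact add_le_add (ih y t₁) (ih (Fin.tail y) t₂)
        _ = _ := by
          refine sum_congr rfl fun x _ => ?_
          rw [htail, embeddingNumber_constWord, embeddingNumber_constWord]
          exact hsplit _ (weight_le σ x)

end Binary

/-! ### Words attaining the maximal embedding number. -/

section Extremal

variable {q : ℕ}

theorem embeddingNumber_le_choose {m n : ℕ} (y : Word q m) (x : Word q n) :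
    embeddingNumber y x ≤ n.choose m := by
  induction n generalizing m with
  | zero =>
    cases m with
    | zero => simp [embeddingNumber_zero_left]
    | succ m => simp [embeddingNumber_zero_right]
  | succ n ih =>
    cases m with
    | zero => simp [embeddingNumber_zero_left]
    | succ m =>
      rw [← Fin.cons_self_tail x, embeddingNumber_cons, Nat.choose_succ_succ]
      have h₁ := ih y (Fin.tail x)
      have h₂ := ih (Fin.tail y) (Fin.tail x)
      simp only [Nat.succ_eq_add_one] at *
      split_ifs <;> omega

/-- If every selection of positions is an embedding, then every position that can carry the
`j`-th letter does carry it. -/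
theorem eq_of_choose_le_embeddingNumber {m n : ℕ} (hmn : m ≤ n) (y : Word q m) (x : Word q n)
    (h : n.choose m ≤ embeddingNumber y x) (j : Fin m) (i : Fin n) (hji : (j : ℕ) ≤ i)
    (hij : (i : ℕ) ≤ j + (n - m)) : x i = y j := by
  induction n generalizing m with
  | zero => exact i.elim0
  | succ n ih =>
    cases m with
    | zero => exact j.elim0
    | succ m =>
      have hmn' : m ≤ n := by omega
      rw [← Fin.cons_self_tail x, embeddingNumber_cons, Nat.choose_succ_succ] at h
      have h₁ := embeddingNumber_le_choose y (Fin.tail x)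
      have h₂ := embeddingNumber_le_choose (Fin.tail y) (Fin.tail x)
      -- Positivity of `n.choose m` excludes a mismatch of first letters, which would leave at most
      -- `n.choose (m + 1)` embeddings.
      have hpos := Nat.choose_pos hmn'
      simp only [Nat.succ_eq_add_one] at *
      split_ifs at h with h0
      · induction i using Fin.cases with
        | zero =>
          obtain rfl : j = 0 := Fin.ext (by simpa using hji)
          exact h0
        | succ i =>
          induction j using Fin.cases with
          | zero =>
            simp only [Fin.val_succ, Fin.val_zero] at hij
            exact ih (by omega) y (Fin.tail x) (by omega) 0 i (by simp)
              (by simp only [Fin.val_zero]; omega)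
          | succ j =>
            simp only [Fin.val_succ] at hij hji
            exact ih hmn' (Fin.tail y) (Fin.tail x) (by omega) j i (by omega) (by omega)
      · omega

/-- As `m < n`, position `j + 1` can carry both letter `j` and letter `j + 1` of `y`, so
neighbouring letters agree. -/
theorem exists_eq_constWord {m n : ℕ} [NeZero q] (hmn : m < n) (y : Word q m) (x : Word q n)
    (h : n.choose m ≤ embeddingNumber y x) : ∃ σ, y = constWord m σ := by
  have key := eq_of_choose_le_embeddingNumber hmn.le y x h
  rcases m with _ | m
  · exact ⟨0, Subsingleton.elim _ _⟩
  · refine ⟨y 0, funext fun j => ?_⟩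
    induction j using Fin.induction with
    | zero => rfl
    | succ j ih =>
      have hlt : (j : ℕ) + 1 < n := by omega
      have e₁ := key j.succ ⟨j + 1, hlt⟩ (by simp) (by simp)
      have e₂ := key j.castSucc ⟨j + 1, hlt⟩ (by simp)
        (by simp only [Fin.val_castSucc]; omega)
      rw [← e₁, e₂, ih]
      rfl

theorem sum_hinge_lt_constWord {m n : ℕ} [NeZero q] (hmn : m < n) (y : Word q m)
    (hy : ¬ ∃ σ, y = constWord m σ) (σ : Fin q) :
    ∑ x : Word q n, (embeddingNumber y x - (n.choose m - 1)) <
      ∑ x : Word q n, (embeddingNumber (constWord m σ) x - (n.choose m - 1)) := by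
  have h0 : ∑ x : Word q n, (embeddingNumber y x - (n.choose m - 1)) = 0 := by
    refine sum_eq_zero fun x _ => ?_
    have : ¬ n.choose m ≤ embeddingNumber y x := fun h => hy (exists_eq_constWord hmn y x h)
    omega
  rw [h0]
  refine lt_of_lt_of_le ?_ (single_le_sum (f := fun x : Word q n =>
    embeddingNumber (constWord m σ) x - (n.choose m - 1)) (fun _ _ => Nat.zero_le _)
    (mem_univ (constWord n σ)))
  have := Nat.choose_pos hmn.le
  simp only [embeddingNumber_constWord, weight_constWord]
  omega

end Extremal

/-! ### From hinges to `k log k`. -/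

section Convexity

/-- Discrete Taylor expansion of a sequence in terms of hinge functions. -/
theorem eq_sum_secondDiff_mul_hinge {f : ℕ → ℝ} (h0 : f 0 = 0) (h1 : f 1 = 0) {k N : ℕ}
    (hk : k ≤ N) :
    f k = ∑ t ∈ range N, (f (t + 2) - 2 * f (t + 1) + f t) * ((k - (t + 1) : ℕ) : ℝ) := by
  have hdiff : ∀ k, ∑ t ∈ range k, (f (t + 2) - 2 * f (t + 1) + f t) = f (k + 1) - f k := by
    intro k
    induction k with
    | zero => simp [h0, h1]
    | succ k ih => rw [sum_range_succ, ih]; ring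
  have hself : ∀ k,
      f k = ∑ t ∈ range k, (f (t + 2) - 2 * f (t + 1) + f t) * ((k - (t + 1) : ℕ) : ℝ) := by
    intro k
    induction k with
    | zero => simp [h0]
    | succ k ih =>
      have e : ∀ t ∈ range k,
          (f (t + 2) - 2 * f (t + 1) + f t) * ((k + 1 - (t + 1) : ℕ) : ℝ) =
            (f (t + 2) - 2 * f (t + 1) + f t) * ((k - (t + 1) : ℕ) : ℝ) +
              (f (t + 2) - 2 * f (t + 1) + f t) := by
        intro t ht
        have ht := mem_range.1 ht
        rw [show k + 1 - (t + 1) = k - (t + 1) + 1 by omega]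
        push_cast
        ring
      rw [sum_range_succ, sum_congr rfl e, sum_add_distrib, ← ih, hdiff]
      simp
  rw [hself k]
  refine sum_subset (range_mono hk) fun t _ ht => ?_
  have : k - (t + 1) = 0 := by simp only [mem_range] at ht; omega
  simp [this]

theorem sum_eq_sum_secondDiff_mul_hinge {f : ℕ → ℝ} (h0 : f 0 = 0) (h1 : f 1 = 0)
    {ι : Type*} [Fintype ι] (u : ι → ℕ) {N : ℕ} (hu : ∀ i, u i ≤ N) :
    ∑ i, f (u i) =
      ∑ t ∈ range N, (f (t + 2) - 2 * f (t + 1) + f t) * ((∑ i, (u i - (t + 1)) : ℕ) : ℝ) := by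
  rw [sum_congr rfl fun i _ => eq_sum_secondDiff_mul_hinge h0 h1 (hu i), sum_comm]
  refine sum_congr rfl fun t _ => ?_
  rw [Nat.cast_sum, mul_sum]

/-- Strict midpoint convexity of `x log x` on `[0, ∞)`, applied to `t` and `t + 2`. -/
theorem secondDiff_mul_logb_pos (t : ℕ) :
    0 < ((t + 2 : ℕ) : ℝ) * Real.logb 2 ((t + 2 : ℕ) : ℝ) -
      2 * (((t + 1 : ℕ) : ℝ) * Real.logb 2 ((t + 1 : ℕ) : ℝ)) + (t : ℝ) * Real.logb 2 t := by
  obtain ⟨-, hconv⟩ := Real.strictConvexOn_mul_log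
  have h := hconv (x := (t : ℝ)) (Set.mem_Ici.2 (by positivity)) (y := (t : ℝ) + 2)
    (Set.mem_Ici.2 (by positivity)) (by simp)
    (a := 1 / 2) (b := 1 / 2) (by norm_num) (by norm_num) (by norm_num)
  simp only [smul_eq_mul] at h
  rw [show (1 / 2 * (t : ℝ) + 1 / 2 * ((t : ℝ) + 2)) = (t : ℝ) + 1 by ring] at h
  have hlog : 0 < Real.log 2 := Real.log_pos one_lt_two
  simp only [Real.logb]
  push_cast
  have e : ((t : ℝ) + 2) * (Real.log (t + 2) / Real.log 2) -
      2 * (((t : ℝ) + 1) * (Real.log (t + 1) / Real.log 2)) + t * (Real.log t / Real.log 2) =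
      (((t : ℝ) + 2) * Real.log (t + 2) - 2 * (((t : ℝ) + 1) * Real.log (t + 1)) +
        t * Real.log t) / Real.log 2 := by ring
  rw [e]
  exact div_pos (by linarith) hlog

/-- Strict comparison of `∑ ω log ω` between a nonconstant and a constant word. -/
theorem sum_mul_logb_lt_constWord {m n : ℕ} (hm : 1 ≤ m) (hmn : m < n) (y : Word 2 m)
    (hy : ¬ ∃ σ, y = constWord m σ) (σ : Fin 2) :
    ∑ x : Word 2 n, (embeddingNumber y x : ℝ) * Real.logb 2 (embeddingNumber y x) <
      ∑ x : Word 2 n, (embeddingNumber (constWord m σ) x : ℝ) *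
        Real.logb 2 (embeddingNumber (constWord m σ) x) := by
  have ey := sum_eq_sum_secondDiff_mul_hinge
    (f := fun k => (k : ℝ) * Real.logb 2 k) (by simp) (by simp) (fun x : Word 2 n => embeddingNumber y x)
    (fun x => embeddingNumber_le_choose y x)
  have ec := sum_eq_sum_secondDiff_mul_hinge
    (f := fun k => (k : ℝ) * Real.logb 2 k) (by simp) (by simp)
    (fun x : Word 2 n => embeddingNumber (constWord m σ) x)
    (fun x => embeddingNumber_le_choose _ x)
  have hC : 2 ≤ n.choose m := by
    have h₁ : (m + 1).choose m ≤ n.choose m := Nat.choose_mono m hmn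
    rw [Nat.choose_succ_self_right] at h₁
    omega
  refine ey.trans_lt (lt_of_lt_of_eq ?_ ec.symm)
  -- Index `t` carries the hinge at `t + 1`, so the strict threshold `n.choose m - 1` sits at
  -- `n.choose m - 2`; `hC` keeps it in range.
  refine sum_lt_sum (fun t _ => ?_) ⟨n.choose m - 2, mem_range.2 (by omega), ?_⟩
  · refine mul_le_mul_of_nonneg_left ?_ (secondDiff_mul_logb_pos t).le
    exact_mod_cast sum_hinge_le_constWord σ n y (t + 1)
  · refine mul_lt_mul_of_pos_left ?_ (secondDiff_mul_logb_pos _)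
    have := sum_hinge_lt_constWord hmn y hy σ
    rw [show n.choose m - 1 = n.choose m - 2 + 1 by omega] at this
    exact_mod_cast this

end Convexity

/-! ### Entropy formulas and strict comparison. -/

section Entropy

/-- The uniform prior and the channel's binomial factor cancel in the posterior, leaving `ω / T`
with `T` independent of `y`. -/
theorem delInputEntropy_eq (k : ℕ) {m : ℕ} (y : Word 2 m) :
    delInputEntropy 2 k m y = Real.logb 2 (((m + k).choose k : ℝ) * 2 ^ k) -
      (∑ x : Word 2 (m + k), (embeddingNumber y x : ℝ) * Real.logb 2 (embeddingNumber y x)) /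
        (((m + k).choose k : ℝ) * 2 ^ k) := by
  have hC : (0 : ℝ) < (m + k).choose k := by exact_mod_cast Nat.choose_pos (Nat.le_add_left k m)
  have hT : ∑ x : Word 2 (m + k), (embeddingNumber y x : ℝ) = ((m + k).choose k : ℝ) * 2 ^ k := by
    exact_mod_cast sum_embeddingNumber k y
  have hcard : (0 : ℝ) < Fintype.card (Word 2 (m + k)) := by exact_mod_cast Fintype.card_pos
  set T : ℝ := ((m + k).choose k : ℝ) * 2 ^ k with hTdef
  have hTpos : 0 < T := by positivity
  have hpost : ∀ x, posterior (delChannel 2 k m) (uniformInput 2 (m + k)) y x =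
      (embeddingNumber y x : ℝ) / T := by
    intro x
    simp only [posterior, delChannel, uniformInput]
    rw [← sum_mul, ← sum_div, hT]
    field_simp
  have hterm : ∀ x : Word 2 (m + k),
      (embeddingNumber y x : ℝ) / T * Real.logb 2 ((embeddingNumber y x : ℝ) / T) =
        ((embeddingNumber y x : ℝ) * Real.logb 2 (embeddingNumber y x)) / T -
          (embeddingNumber y x : ℝ) * (Real.logb 2 T / T) := by
    intro x
    by_cases h : (embeddingNumber y x : ℝ) = 0
    · simp [h]
    · rw [Real.logb_div h hTpos.ne']
      ring
  simp only [delInputEntropy, inputEntropy, entropy, hpost, hterm]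
  rw [sum_sub_distrib, ← sum_div, ← sum_mul, hT, mul_div_cancel₀ _ hTpos.ne']
  ring

theorem delInputEntropy_constWord (m : ℕ) (σ : Fin 2) :
    delInputEntropy 2 2 m (constWord m σ) =
      2 + 3 / 4 * Real.logb 2 ((m + 2).choose 2 : ℝ) - 1 / 2 * Real.logb 2 ((m : ℝ) + 1) := by
  have hC : (0 : ℝ) < (m + 2).choose 2 := by exact_mod_cast Nat.choose_pos (Nat.le_add_left 2 m)
  have hC2 : ((m + 2).choose 2 : ℝ) * 2 = ((m : ℝ) + 2) * (m + 1) := by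
    have := Nat.cast_choose_two ℝ (m + 2)
    rw [this]
    push_cast
    ring
  rw [delInputEntropy_eq]
  simp only [embeddingNumber_constWord]
  -- Only weights `m`, `m + 1`, `m + 2` contribute, with embedding numbers `1`, `m + 1` and `(m +
  -- 2).choose 2`.
  rw [sum_weight σ (fun w => ((w.choose m : ℕ) : ℝ) * Real.logb 2 ((w.choose m : ℕ) : ℝ)),
    sum_range_succ, sum_range_succ, sum_range_succ, sum_eq_zero]
  · have h₁ : (m + 2).choose (m + 1) = m + 2 := Nat.choose_succ_self_right (m + 1)
    have h₂ : (m + 2).choose m = (m + 2).choose 2 := Nat.choose_symm_add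
    simp only [Nat.choose_self, h₁, h₂, Nat.choose_succ_self_right, Nat.cast_one, Real.logb_one]
    have h4 : Real.logb 2 ((2 : ℝ) ^ 2) = 2 := by
      rw [Real.logb_pow, Real.logb_self_eq_one one_lt_two]; norm_num
    rw [Real.logb_mul hC.ne' (by norm_num), h4]
    push_cast
    have e : (0 + ((m + 2).choose 2 : ℝ) * (1 * 0) +
        ((m : ℝ) + 2) * ((m + 1) * Real.logb 2 (m + 1)) +
        1 * (((m + 2).choose 2 : ℝ) * Real.logb 2 ((m + 2).choose 2 : ℝ))) =
        ((m + 2).choose 2 : ℝ) * (2 * Real.logb 2 (m + 1) +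
          Real.logb 2 ((m + 2).choose 2 : ℝ)) := by
      linear_combination (-Real.logb 2 ((m : ℝ) + 1)) * hC2
    rw [e, mul_div_mul_left _ _ hC.ne']
    ring
  · intro w hw
    simp [Nat.choose_eq_zero_of_lt (mem_range.1 hw)]

theorem delInputEntropy_constWord_lt {m k : ℕ} (hk : 1 ≤ k) (y : Word 2 m)
    (hy : ¬ ∃ σ, y = constWord m σ) (σ : Fin 2) :
    delInputEntropy 2 k m (constWord m σ) < delInputEntropy 2 k m y := by
  have hm : 1 ≤ m := by
    rcases m with _ | m
    · exact absurd ⟨0, Subsingleton.elim _ _⟩ hy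
    · omega
  have hC : (0 : ℝ) < (m + k).choose k := by exact_mod_cast Nat.choose_pos (Nat.le_add_left k m)
  rw [delInputEntropy_eq, delInputEntropy_eq]
  exact sub_lt_sub_left (div_lt_div_of_pos_right
    (sum_mul_logb_lt_constWord hm (by omega) y hy σ) (by positivity)) _

end Entropy

end DeletionChannel

/-! ### The minimizers and the minimum. -/

theorem mainTheorem2 (m n : ℕ) (hn : n = m + 2) :
    (∀ y : DeletionChannel.Word 2 m,
      (∀ z : DeletionChannel.Word 2 m,
        DeletionChannel.delInputEntropy 2 2 m y ≤ DeletionChannel.delInputEntropy 2 2 m z) ↔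
      ∃ σ : Fin 2, y = DeletionChannel.constWord m σ) ∧
    (∀ σ : Fin 2, DeletionChannel.delInputEntropy 2 2 m (DeletionChannel.constWord m σ) =
      2 + 3 / 4 * Real.logb 2 (n.choose 2 : ℝ) - 1 / 2 * Real.logb 2 ((m : ℝ) + 1)) ∧
    IsLeast (Set.range (DeletionChannel.delInputEntropy 2 2 m))
      (2 + 3 / 4 * Real.logb 2 (n.choose 2 : ℝ) - 1 / 2 * Real.logb 2 ((m : ℝ) + 1)) := by
  subst hn
  have hmin : ∀ (σ : Fin 2) (z : DeletionChannel.Word 2 m),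
      DeletionChannel.delInputEntropy 2 2 m (DeletionChannel.constWord m σ) ≤
        DeletionChannel.delInputEntropy 2 2 m z := by
    intro σ z
    by_cases hz : ∃ τ, z = DeletionChannel.constWord m τ
    · obtain ⟨τ, rfl⟩ := hz
      rw [DeletionChannel.delInputEntropy_constWord, DeletionChannel.delInputEntropy_constWord]
    · exact (DeletionChannel.delInputEntropy_constWord_lt one_le_two z hz σ).le
  refine ⟨fun y => ⟨fun h => ?_, ?_⟩, DeletionChannel.delInputEntropy_constWord m, ?_, ?_⟩
  · by_contra hy
    exact (h _).not_gt (DeletionChannel.delInputEntropy_constWord_lt one_le_two y hy 0)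
  · rintro ⟨σ, rfl⟩
    exact hmin σ
  · exact ⟨_, DeletionChannel.delInputEntropy_constWord m 0⟩
  · rintro _ ⟨z, rfl⟩
    rw [← DeletionChannel.delInputEntropy_constWord m 0]
    exact hmin 0 z
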